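/- Let $\tau$ be in the upper half-plane and $q=e^{2\pi i\tau}$; for real $x$ write $q^{x}=e^{2\pi i\tau x}$. Put $$P=1-24\sum_{n\ge1}\frac{nq^n}{1-q^n},\quad Q=1+240\sum_{n\ge1}\frac{n^3q^n}{1-q^n},\quad R=1-504\sum_{n\ge1}\frac{n^5q^n}{1-q^n},\quad \eta=q^{1/24}\prod_{n\ge1}(1-q^n).$$ Let $$\vartheta_1(z)=\sum_{n=-\infty}^{\infty}(-1)^{n-1/2}e^{\pi i\tau(n+1/2)^2}e^{(2n+1)iz}\qquad(z\in\mathbb C),$$ where $(-1)^{n-1/2}=-i(-1)^n$, and for integers $m\ge0$ let $$S_3(m)=\sum_{a\in\mathbb Z,\ a\equiv1\ (\mathrm{mod}\ 4)}q^{a^2/8}a^m .$$ Then, with derivatives taken in $z$, $$\tfrac12\vartheta_1^{(9)}(0)=S_3(9)=\tfrac13\eta^3\left(35P^4-84P^2Q-12Q^2+64PR\right),$$ $$-\tfrac12\vartheta_1^{(11)}(0)=S_3(11)=\tfrac19\eta^3\left(385P^5-1540P^3Q-660PQ^2+1760P^2R+64QR\right),$$ $$\tfrac12\vartheta_1^{(13)}(0)=S_3(13)=\tfrac1{27}\eta^3\left(5005P^6-30030P^4Q-25740P^2Q^2+552Q^3+45760P^3R+4992PQR-512R^2\right),$$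 $$-\tfrac12\vartheta_1^{(15)}(0)=S_3(15)=\tfrac1{27}\eta^3\left(25025P^7-210210P^5Q-300300P^3Q^2+19320PQ^3+400400P^4R+87360P^2QR-3648Q^2R-17920PR^2\right).$$ -/

import Mathlib

namespace ThetaEval

/-- The nome `q = e^{2πiτ}`. -/
noncomputable def nome (τ : ℂ) : ℂ := Complex.exp (2 * Real.pi * Complex.I * τ)

/-- `Φ_ν(q) = ∑_{n ≥ 1} n^ν q^n / (1 - q^n)`. -/
noncomputable def Phi (ν : ℕ) (q : ℂ) : ℂ :=
  ∑' n : ℕ+, ((n : ℕ) : ℂ) ^ ν * q ^ (n : ℕ) / (1 - q ^ (n : ℕ))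

/-- Ramanujan's Eisenstein series of weight 2. -/
noncomputable def P (q : ℂ) : ℂ := 1 - 24 * Phi 1 q

/-- Ramanujan's Eisenstein series of weight 4. -/
noncomputable def Q (q : ℂ) : ℂ := 1 + 240 * Phi 3 q

/-- Ramanujan's Eisenstein series of weight 6. -/
noncomputable def R (q : ℂ) : ℂ := 1 - 504 * Phi 5 q

/-- The first theta function `ϑ₁(z, τ) = ∑_{n ∈ ℤ} (-1)^{n - 1/2} q₁^{(n + 1/2)²} e^{(2n+1)iz}`,
where `q₁^x = e^{πiτx}`, so `q₁² = q`. The principal power `(-1)^{n - 1/2}` is `-i (-1)^n`. -/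
noncomputable def theta1 (z τ : ℂ) : ℂ :=
  ∑' n : ℤ, (-1 : ℂ) ^ ((n : ℂ) - 1 / 2) *
    Complex.exp (Real.pi * Complex.I * τ * ((n : ℂ) + 1 / 2) ^ 2) *
    Complex.exp ((2 * (n : ℂ) + 1) * Complex.I * z)

/-- `S₃(m) = ∑_{a ≡ 1 (mod 4)} q^{a²/8} a^m`, the sum being over all integers `a ≡ 1 (mod 4)`,
where `q^x = e^{2πiτx}`. -/
noncomputable def S3 (m : ℕ) (τ : ℂ) : ℂ :=
  ∑' a : {a : ℤ // a ≡ 1 [ZMOD 4]},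
    Complex.exp (2 * Real.pi * Complex.I * τ * ((a.1 : ℂ) ^ 2 / 8)) * (a.1 : ℂ) ^ m

end ThetaEval

/-!
Write `D = (2πi)⁻¹ d/dτ`, and let `T m τ = ∑_{n ∈ ℤ} (-1)ⁿ (2n + 1)ᵐ q^{(2n+1)²/8}`
(`thetaMoment m 0 τ`). Splitting the sum by the parity of `n` gives `T m = 2 S₃(m)` for odd `m`
(`S3_eq`), and differentiating the theta series termwise in `z` identifies `T m`, up to a power
of `i`, with the `m`-th derivative of `ϑ₁` at `0` (`iteratedDeriv_theta1`).

Differentiating termwise in `τ` instead gives `8 D T(m) = T(m + 2)`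
(`hasDerivAt_thetaMoment_snd`), so that all odd moments follow from `T 1` by repeated
differentiation. Two facts make the result a polynomial in `P`, `Q`, `R` times `η³`.

* Jacobi's identity `T 1 = 2 η³` (`thetaMoment_one_eq`). It comes from the `q`-binomial expansion
  of `∏_{k ≤ 2n} (1 + q^k x)`: this polynomial has a simple zero at `x = -q^{-n}`, and evaluating
  its derivative there gives a finite identity (`sum_qBinomialPoly_eq`) in which `n → ∞` is taken
  by dominated convergence.
* The closure of `ℂ[P, Q, R]` under `D`, that is, Ramanujan's identities
  `D P = (P² - Q) / 12`, `D Q = (P Q - R) / 3`, `D R = (P R - Q²) / 2`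
  (`ramanujan_E2`, `ramanujan_E4`, `ramanujan_E6`). In each of them the difference of the two
  sides is invariant under `SL(2, ℤ)` in weight `4`, `6` or `8` and vanishes at `i∞`, hence is a
  cusp form of level one and weight below twelve, hence zero.

Since `D η³ = η³ P / 8`, an evaluation `T m = 2 η³ G` yields `T (m + 2) = 2 η³ (8 D G + P G)`
(`thetaMoment_add_two`), and seven steps of this recursion, starting from `G = 1`, reach `m = 15`.
-/

namespace ThetaEval

open UpperHalfPlane hiding I
open Complex Filter Topology ModularForm EisensteinSeries Derivative OnePoint
open scoped Real Manifold MatrixGroups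

/-! ### Level-one forms and Ramanujan's differential equations -/

/-- A convergent `q`-expansion tends to its constant term at `i∞`. The terms are dominated, for `τ`
high enough, by those at `τ = i`. -/
theorem tendsto_atImInfty_of_hasSum_qParam {f : ℍ → ℂ} {c : ℕ → ℂ}
    (hf : ∀ τ : ℍ, HasSum (fun m ↦ c m * Function.Periodic.qParam 1 τ ^ m) (f τ)) :
    Tendsto f atImInfty (𝓝 (c 0)) := by
  have hq := qParam_tendsto_atImInfty one_pos
  have key : Tendsto (fun τ : ℍ ↦ ∑' m, c m * Function.Periodic.qParam 1 τ ^ m) atImInfty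
      (𝓝 (∑' m, c m * (0 : ℂ) ^ m)) := by
    refine tendsto_tsum_of_dominated_convergence (hf UpperHalfPlane.I).summable.norm
      (fun m ↦ (hq.pow m).const_mul (c m)) ?_
    filter_upwards [hq.norm.eventually_le_const (u := ‖Function.Periodic.qParam 1 UpperHalfPlane.I‖)
      (by simp [Function.Periodic.qParam])] with τ hτ m
    rw [norm_mul, norm_mul, norm_pow, norm_pow]
    gcongr
  have h0 : ∑' m, c m * (0 : ℂ) ^ m = c 0 := by
    rw [tsum_eq_single 0 fun m hm ↦ by simp [hm]]
    simp
  rw [h0] at key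
  exact key.congr fun τ ↦ (hf τ).tsum_eq

/-- The Cauchy estimate on a disc of radius one: a holomorphic function with a limit at `i∞` has
derivative tending to zero there. -/
theorem isZeroAtImInfty_normalizedDeriv {F : ℍ → ℂ} (hF : MDiff F) {c : ℂ}
    (hc : Tendsto F atImInfty (𝓝 c)) : IsZeroAtImInfty (normalizedDerivOfComplex F) := by
  have hzero : IsZeroAtImInfty (fun z ↦ F z - c) := by
    have := hc.sub_const c
    rwa [sub_self] at this
  rw [isZeroAtImInfty_iff] at hzero ⊢
  intro ε hε
  obtain ⟨A, hA⟩ := hzero (ε * (2 * π)) (by positivity)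
  refine ⟨max A 0 + 2, fun z hz ↦ ?_⟩
  have hd : DifferentiableOn ℂ (fun w ↦ (F ∘ ofComplex) w - c) (Metric.closedBall (z : ℂ) 1) := by
    intro w hw
    have hw' : 0 < w.im := by
      have h1 := (abs_im_le_norm (w - z)).trans (by simpa [dist_eq_norm] using hw)
      have := (abs_le.mp h1).1
      have := le_max_right A 0
      simp only [sub_im, coe_im] at *
      linarith
    exact (((UpperHalfPlane.mdifferentiable_iff.mp hF).differentiableAt
      (isOpen_upperHalfPlaneSet.mem_nhds hw')).sub_const c).differentiableWithinAt
  have hb := Complex.norm_deriv_le_of_forall_mem_sphere_norm_le (C := ε * (2 * π)) one_pos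
    (hd.diffContOnCl_ball subset_rfl) (fun w hw ↦ by
      have h1 := (abs_im_le_norm (w - z)).trans (le_of_eq (by simpa [dist_eq_norm] using hw))
      have h2 := (abs_le.mp h1).1
      have h3 := le_max_right A 0
      have h4 := le_max_left A 0
      simp only [sub_im, coe_im] at h2
      have hw' : 0 < w.im := by linarith
      have := hA ⟨w, hw'⟩ (show A ≤ w.im by linarith)
      simpa [ofComplex_apply_of_im_pos hw'] using this)
  rw [deriv_sub_const, div_one] at hb
  rw [normalizedDerivOfComplex, norm_mul]
  have : ‖(2 * π * Complex.I : ℂ)⁻¹‖ = (2 * π)⁻¹ := by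
    simp [abs_of_pos Real.pi_pos]
  rw [this, inv_mul_le_iff₀ (by positivity)]
  linarith

/-- There are no nonzero cusp forms of level one and weight below twelve. -/
theorem eq_zero_of_slash_invariant_of_isZeroAtImInfty {k : ℤ} (hk : k < 12) {G : ℍ → ℂ}
    (hG : MDiff G) (hinv : ∀ γ : SL(2, ℤ), G ∣[k] γ = G) (h0 : IsZeroAtImInfty G) : G = 0 := by
  let g : CuspForm 𝒮ℒ k :=
    { toFun := G
      slash_action_eq' := by
        rintro _ ⟨γ, rfl⟩
        exact hinv γ
      holo' := hG
      zero_at_cusps' := fun {c} hc ↦ by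
        rw [Subgroup.IsArithmetic.isCusp_iff_isCusp_SL2Z] at hc
        rw [isZeroAt_iff_forall_SL2Z hc]
        intro γ _
        rwa [hinv γ] }
  have := rank_zero_iff_forall_zero.mp (CuspForm.rank_eq_zero_of_weight_lt_twelve hk) g
  exact congrArg (fun f : CuspForm 𝒮ℒ k ↦ (f : ℍ → ℂ)) this

theorem tendsto_E2 : Tendsto E2 atImInfty (𝓝 1) := by
  simpa using tendsto_atImInfty_of_hasSum_qParam
    (c := fun m : ℕ ↦ (if m = 0 then 1 else -24 * ArithmeticFunction.sigma 1 m : ℂ))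
    fun τ ↦ by simpa [Function.Periodic.qParam] using hasSum_qExpansion_E2 (z := τ)

theorem tendsto_E {k : ℕ} (hk : 3 ≤ k) (hk2 : Even k) : Tendsto (E hk) atImInfty (𝓝 1) := by
  rw [← E_qExpansion_coeff_zero hk hk2]
  exact tendsto_atImInfty_of_hasSum_qParam
    fun τ ↦ by
      simpa using hasSum_qExpansion (f := E hk) one_pos one_mem_strictPeriods_SL τ

theorem E_slash {k : ℕ} (hk : 3 ≤ k) (γ : SL(2, ℤ)) :
    (E hk : ℍ → ℂ) ∣[(k : ℤ)] γ = E hk :=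
  SlashInvariantForm.slash_action_eqn (E hk) _ ⟨γ, rfl⟩

/-- `D E₂ - E₂² / 12` is invariant of weight four: with `u = c / (2πi (cτ + d))` one has
`E₂ ∣[2] γ = E₂ + 12 u`, and both terms acquire the same correction `2 u E₂ + 12 u²`. -/
theorem D_E2_sub_slash (γ : SL(2, ℤ)) :
    (normalizedDerivOfComplex E2 - (12 : ℂ)⁻¹ • (E2 * E2)) ∣[(4 : ℤ)] γ =
      normalizedDerivOfComplex E2 - (12 : ℂ)⁻¹ • (E2 * E2) := by
  have hE := E2_slash_action γ
  have hs := normalizedDerivOfComplex_SL_slash (k := 2) E2_mdifferentiable (γ := γ)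
  have hm := ModularForm.mul_slash_SL2 2 2 γ E2 E2
  set u : ℍ → ℂ := fun z ↦ (2 * π * Complex.I)⁻¹ * ((γ 1 0 : ℂ) / denom γ z) with hu
  have hE' : E2 ∣[(2 : ℤ)] γ = E2 + (12 : ℂ) • u := by
    rw [hE]
    ext z
    have hpi : (π : ℂ) ≠ 0 := by exact_mod_cast Real.pi_ne_zero
    have hI := Complex.I_sq
    simp only [D2, hu, Pi.sub_apply, Pi.add_apply, Pi.smul_apply, smul_eq_mul, riemannZeta_two]
    have hd := denom_ne_zero γ z
    field_simp
    linear_combination (-(12 * (γ 1 0 : ℂ))) * hI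
  have hud : ∀ z : ℍ, HasDerivAt (u ∘ ofComplex)
      (-((2 * π * Complex.I)⁻¹ * ((γ 1 0 : ℂ) / denom γ z) ^ 2)) (z : ℂ) := by
    intro z
    have h1 := (hasDerivAt_denom_zpow (γ : GL (Fin 2) ℝ) (-1) z).const_mul
      ((2 * π * Complex.I)⁻¹ * (γ 1 0 : ℂ))
    have hd := denom_ne_zero γ z
    refine (h1.congr_of_eventuallyEq ?_).congr_deriv ?_
    · filter_upwards [isOpen_upperHalfPlaneSet.mem_nhds z.im_pos] with w hw
      simp only [Function.comp_apply, hu, ofComplex_apply_of_im_pos hw, zpow_neg_one]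
      ring_nf
    · have h2 : ((-1 : ℤ) : ℂ) = -1 := by norm_num
      have h3 : ((γ : GL (Fin 2) ℝ) 1 0 : ℂ) = (γ 1 0 : ℂ) := by simp
      rw [h2, h3, show (-1 - 1 : ℤ) = -2 by norm_num, zpow_neg, zpow_ofNat]
      field_simp
  have humd : MDiff u := by
    rw [UpperHalfPlane.mdifferentiable_iff]
    intro w hw
    exact (hud ⟨w, hw⟩).differentiableAt.differentiableWithinAt
  have huD : normalizedDerivOfComplex u = -(u * u) := by
    ext z
    rw [normalizedDerivOfComplex, (hud z).deriv]
    simp only [hu, Pi.neg_apply, Pi.mul_apply]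
    ring
  have hDs : normalizedDerivOfComplex E2 ∣[(4 : ℤ)] γ =
      normalizedDerivOfComplex E2 + (2 : ℂ) • (u * E2) + (12 : ℂ) • (u * u) := by
    ext z
    have h1 := congrFun hs z
    rw [hE', normalizedDerivOfComplex_add _ _ E2_mdifferentiable (humd.const_smul _),
      normalizedDerivOfComplex_smul _ _ humd, huD] at h1
    simp only [Pi.add_apply, Pi.sub_apply, Pi.smul_apply, Pi.mul_apply, Pi.neg_apply,
      smul_eq_mul] at h1 ⊢
    rw [show (2 + 2 : ℤ) = 4 by norm_num, Int.cast_ofNat] at h1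
    have h2 : u z = (2 * π * Complex.I)⁻¹ * ((γ 1 0 : ℂ) / denom γ z) := rfl
    linear_combination -h1 + 2 * (E2 z + 12 * u z) * h2
  have hms : (E2 * E2) ∣[(4 : ℤ)] γ = (E2 + (12 : ℂ) • u) * (E2 + (12 : ℂ) • u) := by
    rw [← hE']
    exact hm
  rw [sub_eq_add_neg, SlashAction.add_slash, SlashAction.neg_slash, SL_smul_slash, hDs, hms]
  ext z
  simp only [Pi.add_apply, Pi.neg_apply, Pi.smul_apply, Pi.mul_apply, smul_eq_mul]
  ring

theorem serreDerivative_E_slash {k : ℕ} (hk : 3 ≤ k) (γ : SL(2, ℤ)) :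
    serreDerivative k (E hk) ∣[(k + 2 : ℤ)] γ = serreDerivative k (E hk) :=
  serreDerivative_slash_invariant (k := k) (E hk).holo' (E_slash hk γ)

theorem tendsto_serreDerivative {F : ℍ → ℂ} (k : ℂ) (hF : MDiff F) {c : ℂ}
    (hc : Tendsto F atImInfty (𝓝 c)) :
    Tendsto (serreDerivative k F) atImInfty (𝓝 (-(k * 12⁻¹ * c))) := by
  have := (isZeroAtImInfty_normalizedDeriv hF hc).sub ((tendsto_E2.const_mul (k * 12⁻¹)).mul hc)
  simpa using this

theorem ramanujan_E2 (τ : ℍ) :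
    normalizedDerivOfComplex E2 τ = (E2 τ ^ 2 - E₄ τ) / 12 := by
  have h4 := tendsto_E (k := 4) (by norm_num) (by decide)
  have key := eq_zero_of_slash_invariant_of_isZeroAtImInfty (k := 4) (by norm_num)
    (G := normalizedDerivOfComplex E2 - (12 : ℂ)⁻¹ • (E2 * E2) + (12 : ℂ)⁻¹ • ⇑E₄)
    (((normalizedDerivOfComplex_mdifferentiable E2_mdifferentiable).sub
      ((E2_mdifferentiable.mul E2_mdifferentiable).const_smul _)).add (E₄.holo'.const_smul _))
    (fun γ ↦ by
      rw [SlashAction.add_slash, D_E2_sub_slash, SL_smul_slash]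
      congr 2
      exact E_slash (k := 4) (by norm_num) γ)
    (by
      have := ((isZeroAtImInfty_normalizedDeriv E2_mdifferentiable tendsto_E2).sub
        ((tendsto_E2.mul tendsto_E2).const_smul (12 : ℂ)⁻¹)).add (h4.const_smul (12 : ℂ)⁻¹)
      simpa [IsZeroAtImInfty, ZeroAtFilter] using! this)
  have := congrFun key τ
  simp only [Pi.add_apply, Pi.sub_apply, Pi.smul_apply, Pi.mul_apply, Pi.zero_apply,
    smul_eq_mul] at this
  linear_combination this

theorem ramanujan_E4 (τ : ℍ) :
    normalizedDerivOfComplex E₄ τ = (E2 τ * E₄ τ - E₆ τ) / 3 := by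
  have h4 := tendsto_E (k := 4) (by norm_num) (by decide)
  have h6 := tendsto_E (k := 6) (by norm_num) (by decide)
  have key := eq_zero_of_slash_invariant_of_isZeroAtImInfty (k := 6) (by norm_num)
    (G := serreDerivative (4 : ℕ) E₄ + (3 : ℂ)⁻¹ • ⇑E₆)
    ((serreDerivative_mdifferentiable _ E₄.holo').add (E₆.holo'.const_smul _))
    (fun γ ↦ by
      rw [SlashAction.add_slash, SL_smul_slash]
      congr 2
      · exact serreDerivative_E_slash (k := 4) (by norm_num) γ
      · exact E_slash (k := 6) (by norm_num) γ)
    (by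
      have := (tendsto_serreDerivative (4 : ℕ) E₄.holo' h4).add (h6.const_smul (3 : ℂ)⁻¹)
      rw [show -(((4 : ℕ) : ℂ) * 12⁻¹ * 1) + (3 : ℂ)⁻¹ • (1 : ℂ) = 0 by norm_num] at this
      exact this)
  have := congrFun key τ
  simp only [Pi.add_apply, Pi.smul_apply, Pi.zero_apply, smul_eq_mul,
    serreDerivative_apply] at this
  push_cast at this
  linear_combination this

theorem ramanujan_E6 (τ : ℍ) :
    normalizedDerivOfComplex E₆ τ = (E2 τ * E₆ τ - E₄ τ ^ 2) / 2 := by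
  have h4 := tendsto_E (k := 4) (by norm_num) (by decide)
  have h6 := tendsto_E (k := 6) (by norm_num) (by decide)
  have key := eq_zero_of_slash_invariant_of_isZeroAtImInfty (k := 8) (by norm_num)
    (G := serreDerivative (6 : ℕ) E₆ + (2 : ℂ)⁻¹ • (⇑E₄ * ⇑E₄))
    ((serreDerivative_mdifferentiable _ E₆.holo').add ((E₄.holo'.mul E₄.holo').const_smul _))
    (fun γ ↦ by
      rw [SlashAction.add_slash, SL_smul_slash]
      congr 2
      · exact serreDerivative_E_slash (k := 6) (by norm_num) γ
      · have h := E_slash (k := 4) (by norm_num) γ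
        have hm := ModularForm.mul_slash_SL2 4 4 γ (E₄ : ℍ → ℂ) E₄
        exact hm.trans (congrArg₂ _ h h))
    (by
      have := (tendsto_serreDerivative (6 : ℕ) E₆.holo' h6).add
        ((h4.mul h4).const_smul (2 : ℂ)⁻¹)
      rw [show -(((6 : ℕ) : ℂ) * 12⁻¹ * 1) + (2 : ℂ)⁻¹ • (1 * 1 : ℂ) = 0 by norm_num] at this
      exact this)
  have := congrFun key τ
  simp only [Pi.add_apply, Pi.smul_apply, Pi.mul_apply, Pi.zero_apply, smul_eq_mul,
    serreDerivative_apply] at this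
  push_cast at this
  linear_combination this

theorem P_nome (τ : ℍ) : P (nome τ) = E2 τ := by
  rw [P, Phi, E2_eq_tsum_cexp, ← tsum_pow_div_one_sub_eq_tsum_sigma
    (by simpa [Function.Periodic.qParam] using norm_exp_two_pi_I_lt_one τ)]
  simp [nome]

theorem Q_nome (τ : ℍ) : Q (nome τ) = E₄ τ := by
  rw [Q, Phi, q_expansion_bernoulli _ (by decide)]
  simp only [zpow_natCast]
  rw [← tsum_pow_div_one_sub_eq_tsum_sigma (norm_exp_two_pi_I_lt_one τ),
    show bernoulli 4 = -1 / 30 by decide +kernel]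
  norm_num [nome]

theorem R_nome (τ : ℍ) : R (nome τ) = E₆ τ := by
  rw [R, Phi, q_expansion_bernoulli _ (by decide)]
  simp only [zpow_natCast]
  rw [← tsum_pow_div_one_sub_eq_tsum_sigma (norm_exp_two_pi_I_lt_one τ),
    show bernoulli 6 = 1 / 42 by decide +kernel]
  norm_num [nome]

/-! ### Termwise differentiation of the theta series -/

/-- The `n`-th term of the series for `i ϑ₁(z, τ)`, with the extra factor `(2n + 1)ᵐ` that `m`-fold
differentiation in `z` produces (its power of `i` left out). -/
noncomputable def thetaTerm (m : ℕ) (z τ : ℂ) (n : ℤ) : ℂ :=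
  (-1) ^ n * (2 * n + 1) ^ m * cexp (π * I * τ * (n + 1 / 2) ^ 2) * cexp ((2 * n + 1) * I * z)

/-- The series `∑_{n ∈ ℤ} (-1)ⁿ (2n + 1)ᵐ q^{(2n+1)²/8} e^{(2n+1)iz}`. -/
noncomputable def thetaMoment (m : ℕ) (z τ : ℂ) : ℂ := ∑' n : ℤ, thetaTerm m z τ n

/-- A majorant of `thetaTerm m z τ n`, uniform over `|im z| ≤ S` and `T ≤ im τ`. -/
noncomputable def thetaBound (m : ℕ) (S T : ℝ) (n : ℤ) : ℝ :=
  |2 * (n : ℝ) + 1| ^ m *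
    Real.exp (-π * (T / 4 * (2 * (n : ℝ) + 1) ^ 2 - 2 * (S / (2 * π)) * |2 * (n : ℝ) + 1|))

theorem summable_thetaBound (m : ℕ) (S : ℝ) {T : ℝ} (hT : 0 < T) :
    Summable (thetaBound m S T) := by
  have h := (summable_pow_mul_jacobiTheta₂_term_bound (S / (2 * π)) (T := T / 4) (by positivity)
    m).comp_injective (i := fun n : ℤ ↦ 2 * n + 1) (fun a b h ↦ by simpa using h)
  refine h.congr fun n ↦ ?_
  simp [thetaBound]

theorem norm_thetaTerm_le (m : ℕ) {S T : ℝ} {z τ : ℂ} (hz : |z.im| ≤ S) (hτ : T ≤ τ.im) (n : ℤ) :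
    ‖thetaTerm m z τ n‖ ≤ thetaBound m S T n := by
  have h1 : ‖((2 * n + 1 : ℂ))‖ = |2 * (n : ℝ) + 1| := by
    rw [← Real.norm_eq_abs, ← Complex.norm_real]; norm_num
  rw [thetaTerm, norm_mul, norm_mul, norm_mul, norm_zpow, norm_neg, norm_one, one_zpow, one_mul,
    norm_pow, h1, Complex.norm_exp, Complex.norm_exp, mul_assoc, ← Real.exp_add, thetaBound]
  gcongr
  have e1 : (π * I * τ * ((n : ℂ) + 1 / 2) ^ 2).re = -(π / 4 * (2 * (n : ℝ) + 1) ^ 2) * τ.im := by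
    rw [show π * I * τ * ((n : ℂ) + 1 / 2) ^ 2 =
      ((π / 4 * (2 * (n : ℝ) + 1) ^ 2 : ℝ) : ℂ) * (τ * I) by push_cast; ring, re_ofReal_mul]
    simp
  have e2 : ((2 * (n : ℂ) + 1) * I * z).re = -((2 * (n : ℝ) + 1) * z.im) := by
    rw [show (2 * (n : ℂ) + 1) * I * z = ((2 * (n : ℝ) + 1 : ℝ) : ℂ) * (z * I) by
      push_cast; ring, re_ofReal_mul]
    simp
  have e3 : -((2 * (n : ℝ) + 1) * z.im) ≤ |2 * (n : ℝ) + 1| * S := by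
    refine (neg_le_abs _).trans ?_
    rw [abs_mul]
    gcongr
  have e4 : π / 4 * (2 * (n : ℝ) + 1) ^ 2 * T ≤ π / 4 * (2 * (n : ℝ) + 1) ^ 2 * τ.im := by gcongr
  rw [e1, e2]
  have e5 : -π * (T / 4 * (2 * (n : ℝ) + 1) ^ 2 - 2 * (S / (2 * π)) * |2 * (n : ℝ) + 1|) =
      -(π / 4 * (2 * (n : ℝ) + 1) ^ 2 * T) + |2 * (n : ℝ) + 1| * S := by
    field_simp
    ring
  rw [e5]
  linarith

theorem summable_thetaTerm (m : ℕ) (z : ℂ) {τ : ℂ} (hτ : 0 < τ.im) :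
    Summable (thetaTerm m z τ) :=
  .of_norm_bounded (summable_thetaBound m |z.im| hτ) fun n ↦ norm_thetaTerm_le m le_rfl le_rfl n

theorem hasDerivAt_thetaTerm_fst (m : ℕ) (z τ : ℂ) (n : ℤ) :
    HasDerivAt (fun w ↦ thetaTerm m w τ n) (I * thetaTerm (m + 1) z τ n) z := by
  have h := (((hasDerivAt_id z).const_mul ((2 * (n : ℂ) + 1) * I)).cexp).const_mul
    ((-1) ^ n * (2 * (n : ℂ) + 1) ^ m * cexp (π * I * τ * (n + 1 / 2) ^ 2))
  refine h.congr_deriv ?_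
  simp only [thetaTerm, id]
  ring

theorem hasDerivAt_thetaTerm_snd (m : ℕ) (z τ : ℂ) (n : ℤ) :
    HasDerivAt (fun w ↦ thetaTerm m z w n) (π * I / 4 * thetaTerm (m + 2) z τ n) τ := by
  have h := ((((hasDerivAt_id τ).const_mul (π * I)).mul_const
    (((n : ℂ) + 1 / 2) ^ 2)).cexp.const_mul ((-1) ^ n * (2 * (n : ℂ) + 1) ^ m)).mul_const
    (cexp ((2 * n + 1) * I * z))
  refine h.congr_deriv ?_
  simp only [thetaTerm, id]
  ring

theorem hasDerivAt_thetaMoment_fst (m : ℕ) (z : ℂ) {τ : ℂ} (hτ : 0 < τ.im) :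
    HasDerivAt (fun w ↦ thetaMoment m w τ) (I * thetaMoment (m + 1) z τ) z := by
  have hU : IsOpen {w : ℂ | |w.im| < |z.im| + 1} :=
    isOpen_lt (continuous_abs.comp continuous_im) continuous_const
  have hzU : z ∈ {w : ℂ | |w.im| < |z.im| + 1} := by simp
  have hu := summable_thetaBound m (|z.im| + 1) hτ
  have hd (n : ℤ) : DifferentiableOn ℂ (fun w ↦ thetaTerm m w τ n) {w : ℂ | |w.im| < |z.im| + 1} :=
    fun w _ ↦ (hasDerivAt_thetaTerm_fst m w τ n).differentiableAt.differentiableWithinAt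
  have hle (n : ℤ) (w : ℂ) (hw : w ∈ {w : ℂ | |w.im| < |z.im| + 1}) :=
    norm_thetaTerm_le m (le_of_lt hw) (le_refl τ.im) n
  have h1 := hasSum_deriv_of_summable_norm hu hd hU hle hzU
  have h2 := (differentiableOn_tsum_of_summable_norm hu hd hU hle).differentiableAt
    (hU.mem_nhds hzU)
  refine h2.hasDerivAt.congr_deriv ?_
  rw [← h1.tsum_eq, thetaMoment, ← tsum_mul_left]
  exact tsum_congr fun n ↦ (hasDerivAt_thetaTerm_fst m z τ n).deriv

theorem hasDerivAt_thetaMoment_snd (m : ℕ) (z : ℂ) {τ : ℂ} (hτ : 0 < τ.im) :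
    HasDerivAt (fun w ↦ thetaMoment m z w) (π * I / 4 * thetaMoment (m + 2) z τ) τ := by
  have hU : IsOpen {w : ℂ | τ.im / 2 < w.im} := isOpen_lt continuous_const continuous_im
  have hτU : τ ∈ {w : ℂ | τ.im / 2 < w.im} := half_lt_self hτ
  have hu := summable_thetaBound m |z.im| (half_pos hτ)
  have hd (n : ℤ) : DifferentiableOn ℂ (fun w ↦ thetaTerm m z w n) {w : ℂ | τ.im / 2 < w.im} :=
    fun w _ ↦ (hasDerivAt_thetaTerm_snd m z w n).differentiableAt.differentiableWithinAt
  have hle (n : ℤ) (w : ℂ) (hw : w ∈ {w : ℂ | τ.im / 2 < w.im}) :=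
    norm_thetaTerm_le m (le_refl |z.im|) (le_of_lt hw) n
  have h1 := hasSum_deriv_of_summable_norm hu hd hU hle hτU
  have h2 := (differentiableOn_tsum_of_summable_norm hu hd hU hle).differentiableAt
    (hU.mem_nhds hτU)
  refine h2.hasDerivAt.congr_deriv ?_
  rw [← h1.tsum_eq, thetaMoment, ← tsum_mul_left]
  exact tsum_congr fun n ↦ (hasDerivAt_thetaTerm_snd m z τ n).deriv

theorem theta1_eq (z τ : ℂ) : theta1 z τ = -I * thetaMoment 0 z τ := by
  rw [theta1, thetaMoment, ← tsum_mul_left]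
  refine tsum_congr fun n ↦ ?_
  have h : (-1 : ℂ) ^ ((n : ℂ) - 1 / 2) = -I * (-1) ^ n := by
    rw [cpow_sub _ _ (by norm_num), cpow_intCast, cpow_def_of_ne_zero (x := -1) (by norm_num),
      log_neg_one, show π * I * (1 / 2) = π / 2 * I by ring, exp_pi_div_two_mul_I, div_I]
    ring
  rw [h, thetaTerm]
  ring

theorem iteratedDeriv_theta1 (k : ℕ) {τ : ℂ} (hτ : 0 < τ.im) :
    iteratedDeriv k (fun z ↦ theta1 z τ) = fun z ↦ -I * I ^ k * thetaMoment k z τ := by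
  induction k with
  | zero => ext z; simp [theta1_eq]
  | succ k ih =>
    ext z
    rw [iteratedDeriv_succ, ih, ((hasDerivAt_thetaMoment_fst k z hτ).const_mul _).deriv]
    ring

/-- The even `n` in the theta series give the integers `2n + 1 ≡ 1 (mod 4)`; the odd `n` give their
negatives, where both `(-1)ⁿ` and the odd power `(2n + 1)ᵐ` change sign. -/
theorem S3_eq {m : ℕ} (hm : Odd m) {τ : ℂ} (hτ : 0 < τ.im) :
    S3 m τ = 1 / 2 * thetaMoment m 0 τ := by
  let e : ℤ ≃ {a : ℤ // a ≡ 1 [ZMOD 4]} :=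
    { toFun j := ⟨4 * j + 1, by simp [Int.ModEq]⟩
      invFun a := a.1 / 4
      left_inv j := by simp; omega
      right_inv a := by
        obtain ⟨a, ha⟩ := a
        simp only [Int.ModEq] at ha
        refine Subtype.ext ?_
        simp only
        omega }
  have hS : S3 m τ = ∑' j : ℤ, thetaTerm m 0 τ (2 * j) := by
    rw [S3, ← e.tsum_eq]
    refine tsum_congr fun j ↦ ?_
    have : (-1 : ℂ) ^ (2 * j) = 1 := by rw [zpow_mul]; norm_num
    simp only [e, Equiv.coe_fn_mk, thetaTerm, this]
    push_cast
    rw [mul_zero, exp_zero, mul_one, one_mul, mul_comm]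
    congr 2 <;> ring
  have hodd : ∑' j : ℤ, thetaTerm m 0 τ (2 * j + 1) = ∑' j : ℤ, thetaTerm m 0 τ (2 * j) := by
    rw [← ((Equiv.neg ℤ).trans (Equiv.subRight 1)).tsum_eq]
    refine tsum_congr fun j ↦ ?_
    have h1 : (-1 : ℂ) ^ (2 * j) = 1 := by rw [zpow_mul]; norm_num
    have h2 : (-1 : ℂ) ^ (2 * (-j - 1) + 1) = -1 := by
      rw [zpow_add₀ (by norm_num), zpow_mul]; norm_num
    simp only [Equiv.trans_apply, Equiv.neg_apply, Equiv.subRight_apply, thetaTerm, h1, h2]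
    push_cast
    rw [show 2 * (2 * (-(j : ℂ) - 1) + 1) + 1 = -(2 * (2 * j) + 1) by ring, hm.neg_pow,
      show (2 * (-(j : ℂ) - 1) + 1 + 1 / 2) ^ 2 = (2 * (j : ℂ) + 1 / 2) ^ 2 by ring]
    simp
  have hs := summable_thetaTerm m 0 hτ
  have hi0 : Function.Injective fun j : ℤ ↦ 2 * j := fun a b h ↦ by simpa using h
  have hi1 : Function.Injective fun j : ℤ ↦ 2 * j + 1 := fun a b h ↦ by simpa using h
  have hc : IsCompl (Set.range fun j : ℤ ↦ 2 * j) (Set.range fun j : ℤ ↦ 2 * j + 1) := by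
    rw [range_two_mul, range_two_mul_add_one]
    exact Int.isCompl_even_odd
  have h := HasSum.add_isCompl hc (hi0.hasSum_range_iff.mpr (hs.comp_injective hi0).hasSum)
    (hi1.hasSum_range_iff.mpr (hs.comp_injective hi1).hasSum)
  have h' := h.tsum_eq
  simp only [Function.comp_def] at h'
  rw [thetaMoment, h', hodd, hS]
  ring

/-! ### Jacobi's identity for the cube of the eta function -/

/-- The finite `q`-Pochhammer symbol `(q; q)_n = ∏_{k=1}^n (1 - q^k)`. -/
noncomputable def qPoch (q : ℂ) (n : ℕ) : ℂ := ∏ k ∈ Finset.range n, (1 - q ^ (k + 1))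

/-- The polynomial `∏_{k < N} (1 + q^k X)`, the generating function of the Gaussian binomials. -/
noncomputable def qBinomialPoly (q : ℂ) (N : ℕ) : Polynomial ℂ :=
  ∏ k ∈ Finset.range N, (1 + Polynomial.C (q ^ k) * Polynomial.X)

theorem qPoch_succ (q : ℂ) (n : ℕ) : qPoch q (n + 1) = qPoch q n * (1 - q ^ (n + 1)) :=
  Finset.prod_range_succ _ _

theorem natDegree_qBinomialPoly_le (q : ℂ) (N : ℕ) : (qBinomialPoly q N).natDegree ≤ N := by
  refine (Polynomial.natDegree_prod_le _ _).trans ?_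
  refine (Finset.sum_le_card_nsmul _ _ 1 fun k _ ↦ ?_).trans (by simp)
  compute_degree

theorem coeff_qBinomialPoly_succ (q : ℂ) (N j : ℕ) :
    (qBinomialPoly q (N + 1)).coeff (j + 1) =
      (qBinomialPoly q N).coeff (j + 1) + q ^ N * (qBinomialPoly q N).coeff j := by
  rw [qBinomialPoly, Finset.prod_range_succ, ← qBinomialPoly, mul_add, mul_one,
    Polynomial.coeff_add, ← mul_assoc, Polynomial.coeff_mul_X, Polynomial.coeff_mul_C, mul_comm]

/-- The `q`-binomial theorem: the coefficient of `X^j` in `∏_{k < i + j} (1 + q^k X)` is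
`q^{j(j-1)/2} (q)_{i+j} / ((q)_i (q)_j)`, stated with denominators cleared. -/
theorem coeff_qBinomialPoly (q : ℂ) (i j : ℕ) :
    (qBinomialPoly q (i + j)).coeff j * (qPoch q i * qPoch q j) =
      q ^ j.choose 2 * qPoch q (i + j) := by
  induction h : i + j generalizing i j with
  | zero =>
    obtain ⟨rfl, rfl⟩ : i = 0 ∧ j = 0 := by omega
    simp [qBinomialPoly, qPoch]
  | succ N ih =>
    rcases j with _ | j
    · obtain rfl : i = N + 1 := by omega
      have : (qBinomialPoly q (N + 1)).coeff 0 = 1 := by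
        rw [Polynomial.coeff_zero_eq_eval_zero, qBinomialPoly, Polynomial.eval_prod]
        simp
      simp [this, qPoch]
    · have hc : (j + 1).choose 2 = j.choose 2 + j := by
        rw [Nat.choose_succ_succ' j 1, Nat.choose_one_right, add_comm]
      rw [coeff_qBinomialPoly_succ, hc, qPoch_succ q N]
      rcases i with _ | i
      · obtain rfl : j = N := by omega
        rw [Polynomial.coeff_eq_zero_of_natDegree_lt
          ((natDegree_qBinomialPoly_le q j).trans_lt j.lt_succ_self)]
        have h2 := ih 0 j (by omega)
        rw [qPoch_succ]
        linear_combination q ^ j * (1 - q ^ (j + 1)) * h2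
      · have h1 := ih i (j + 1) (by omega)
        have h2 := ih (i + 1) j (by omega)
        obtain rfl : N = i + 1 + j := by omega
        rw [hc] at h1
        rw [qPoch_succ q i, qPoch_succ q j] at *
        linear_combination (1 - q ^ (i + 1)) * h1 + q ^ (i + 1 + j) * (1 - q ^ (j + 1)) * h2

theorem qPoch_inv {q : ℂ} (hq : q ≠ 0) (n : ℕ) :
    ∏ k ∈ Finset.range n, (1 - (q ^ (k + 1))⁻¹) =
      (-1) ^ n * (q ^ (n + 1).choose 2)⁻¹ * qPoch q n := by
  induction n with
  | zero => simp [qPoch]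
  | succ n ih =>
    have hc : (n + 1 + 1).choose 2 = (n + 1).choose 2 + (n + 1) := by
      rw [Nat.choose_succ_succ' (n + 1) 1, Nat.choose_one_right, add_comm]
    rw [Finset.prod_range_succ, ih, hc, qPoch_succ, pow_add]
    field_simp
    ring

theorem sum_mul_coeff_mul_pow {p : Polynomial ℂ} {N : ℕ} (hp : p.natDegree ≤ N) (x : ℂ) :
    ∑ j ∈ Finset.range (N + 1), (j : ℂ) * (p.coeff j * x ^ j) = x * p.derivative.eval x := by
  rw [Polynomial.derivative_eval, Polynomial.sum_over_range' _ (by simp) (N + 1) (by omega),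
    Finset.mul_sum]
  refine Finset.sum_congr rfl fun j _ ↦ ?_
  rcases j with _ | j
  · simp
  · simp only [Nat.add_sub_cancel, pow_succ]
    ring

/-- A finite form of Jacobi's identity. At its zero `x = -q^{-n}` the polynomial
`p = ∏_{k ≤ 2n} (1 + q^k X)` has `2 x p'(x) - (2n + 1) p(x) = 2 x p'(x)`, and the product rule
leaves only the term in which the vanishing factor is differentiated. -/
theorem sum_qBinomialPoly_eq {q : ℂ} (hq : q ≠ 0) (n : ℕ) :
    ∑ j ∈ Finset.range (2 * n + 1 + 1), (2 * (j : ℂ) - (2 * n + 1)) *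
      ((qBinomialPoly q (2 * n + 1)).coeff j * (-(q ^ n)⁻¹) ^ j) =
    -2 * (-1) ^ n * (q ^ (n + 1).choose 2)⁻¹ * qPoch q n ^ 2 := by
  set x : ℂ := -(q ^ n)⁻¹ with hx
  set p := qBinomialPoly q (2 * n + 1) with hp
  have hdeg : p.natDegree ≤ 2 * n + 1 := natDegree_qBinomialPoly_le q _
  -- `r` is the product of the factors that do not vanish at `x`
  set r : Polynomial ℂ := (∏ k ∈ Finset.range n, (1 + Polynomial.C (q ^ k) * Polynomial.X)) *
    ∏ k ∈ Finset.range n, (1 + Polynomial.C (q ^ (n + 1 + k)) * Polynomial.X) with hr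
  have hpr : p = (1 + Polynomial.C (q ^ n) * Polynomial.X) * r := by
    rw [hp, qBinomialPoly, show 2 * n + 1 = n + 1 + n by ring, Finset.prod_range_add,
      Finset.prod_range_succ, hr]
    ring
  have hx0 : 1 + q ^ n * x = 0 := by
    rw [hx]; field_simp; ring
  have hev : p.eval x = 0 := by simp [hpr, hx0]
  have hder : p.derivative.eval x = q ^ n * r.eval x := by
    simp [hpr, Polynomial.derivative_mul, hx0, -map_pow]
  have hrx : r.eval x = (-1) ^ n * (q ^ (n + 1).choose 2)⁻¹ * qPoch q n ^ 2 := by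
    rw [hr, Polynomial.eval_mul, Polynomial.eval_prod, Polynomial.eval_prod]
    have h1 : ∏ k ∈ Finset.range n,
        Polynomial.eval x (1 + Polynomial.C (q ^ k) * Polynomial.X) =
        ∏ k ∈ Finset.range n, (1 - (q ^ (k + 1))⁻¹) := by
      rw [← Finset.prod_range_reflect]
      refine Finset.prod_congr rfl fun k hk ↦ ?_
      have hk' := Finset.mem_range.mp hk
      have hn : n = (n - 1 - k) + (k + 1) := by omega
      have hqn : q ^ n = q ^ (n - 1 - k) * q ^ (k + 1) := by rw [← pow_add, ← hn]
      simp only [Polynomial.eval_add, Polynomial.eval_one, Polynomial.eval_mul,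
        Polynomial.eval_C, Polynomial.eval_X, hx, hqn]
      field_simp
      ring
    have h2 : ∏ k ∈ Finset.range n,
        Polynomial.eval x (1 + Polynomial.C (q ^ (n + 1 + k)) * Polynomial.X) = qPoch q n := by
      refine Finset.prod_congr rfl fun k hk ↦ ?_
      simp only [Polynomial.eval_add, Polynomial.eval_one, Polynomial.eval_mul,
        Polynomial.eval_C, Polynomial.eval_X, hx]
      rw [show n + 1 + k = n + (k + 1) by ring, pow_add q n]
      field_simp
      ring
    rw [h1, h2, qPoch_inv hq]
    ring
  have hs1 := sum_mul_coeff_mul_pow hdeg x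
  have hs0 : ∑ j ∈ Finset.range (2 * n + 1 + 1), p.coeff j * x ^ j = 0 := by
    rw [← Polynomial.eval_eq_sum_range' (by omega), hev]
  have : ∑ j ∈ Finset.range (2 * n + 1 + 1), (2 * (j : ℂ) - (2 * n + 1)) * (p.coeff j * x ^ j) =
      2 * ∑ j ∈ Finset.range (2 * n + 1 + 1), (j : ℂ) * (p.coeff j * x ^ j) -
      (2 * n + 1) * ∑ j ∈ Finset.range (2 * n + 1 + 1), p.coeff j * x ^ j := by
    rw [Finset.mul_sum, Finset.mul_sum, ← Finset.sum_sub_distrib]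
    exact Finset.sum_congr rfl fun j _ ↦ by ring
  rw [this, hs0, hs1, hder, hrx]
  linear_combination 2 * ((-1) ^ n * (q ^ (n + 1).choose 2)⁻¹ * qPoch q n ^ 2) * hx0

/-- The Gaussian binomial `(q)_{2n+1} / ((q)_{n-k} (q)_{n+1+k})` for `-(n + 1) ≤ k ≤ n`, and zero
for other `k`. Multiplying the `k`-th theta term by it gives the finite form of Jacobi's identity. -/
noncomputable def jacobiWeight (q : ℂ) (n : ℕ) (k : ℤ) : ℂ :=
  if k ∈ Finset.Icc (-(n + 1) : ℤ) n then
    qPoch q (2 * n + 1) / (qPoch q (n - k).toNat * qPoch q (n + 1 + k).toNat) else 0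

theorem qPoch_ne_zero {q : ℂ} (hq : ‖q‖ < 1) (n : ℕ) : qPoch q n ≠ 0 := by
  refine Finset.prod_ne_zero_iff.mpr fun k _ h ↦ ?_
  have h1 : ‖q ^ (k + 1)‖ = 1 := by rw [← sub_eq_zero.mp h, norm_one]
  rw [norm_pow] at h1
  exact (pow_lt_one₀ (norm_nonneg q) hq k.succ_ne_zero).ne h1

theorem nome_ne_zero (τ : ℂ) : nome τ ≠ 0 := Complex.exp_ne_zero _

theorem norm_nome_lt_one (τ : ℍ) : ‖nome τ‖ < 1 := norm_exp_two_pi_I_lt_one τ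

/-- The finite form of Jacobi's identity, recentred by `j = n + 1 + k` so that its terms are theta
terms. -/
theorem tsum_thetaTerm_mul_jacobiWeight (τ : ℍ) (n : ℕ) :
    ∑' k : ℤ, thetaTerm 1 0 τ k * jacobiWeight (nome τ) n k =
      2 * cexp (π * I * τ / 4) * qPoch (nome τ) n ^ 2 := by
  have hq := nome_ne_zero τ
  set q := nome τ with hqdef
  have hfin := sum_qBinomialPoly_eq hq n
  have hqc : q ^ (n + 1).choose 2 ≠ 0 := pow_ne_zero _ hq
  have hmain : ∑ k ∈ Finset.Icc (-(n + 1) : ℤ) n, thetaTerm 1 0 τ k * jacobiWeight q n k =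
      ∑ j ∈ Finset.range (2 * n + 1 + 1), (-((-1) ^ n * q ^ (n + 1).choose 2 *
        cexp (π * I * τ / 4))) * ((2 * (j : ℂ) - (2 * n + 1)) *
      ((qBinomialPoly q (2 * n + 1)).coeff j * (-(q ^ n)⁻¹) ^ j)) := by
    refine Finset.sum_nbij' (fun k ↦ (n + 1 + k).toNat) (fun j ↦ (j : ℤ) - (n + 1)) ?_ ?_ ?_ ?_ ?_
    · intro k hk; simp only [Finset.mem_Icc, Finset.mem_range] at *; omega
    · intro k hk; simp only [Finset.mem_Icc, Finset.mem_range] at *; omega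
    · intro k hk; simp only [Finset.mem_Icc] at *; omega
    · intro k hk; simp only [Finset.mem_range] at *; omega
    · intro k hk
      have hk' := Finset.mem_Icc.mp hk
      obtain ⟨j, hj⟩ : ∃ j : ℕ, (j : ℤ) = n + 1 + k := ⟨(n + 1 + k).toNat, by omega⟩
      obtain ⟨i, hi⟩ : ∃ i : ℕ, (i : ℤ) = n - k := ⟨(n - k).toNat, by omega⟩
      have hij : i + j = 2 * n + 1 := by omega
      have hkj : k = (j : ℤ) - (n + 1) := by omega
      have hco := coeff_qBinomialPoly q i j
      rw [jacobiWeight, if_pos hk, ← hj, ← hi, Int.toNat_natCast, Int.toNat_natCast]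
      rw [hij] at hco
      have hne := mul_ne_zero (qPoch_ne_zero (norm_nome_lt_one τ) i)
        (qPoch_ne_zero (norm_nome_lt_one τ) j)
      rw [← hqdef] at hne
      rw [eq_div_of_mul_eq hne hco]
      have hexp : cexp (π * I * τ * ((k : ℂ) + 1 / 2) ^ 2) =
          q ^ (n + 1).choose 2 * cexp (π * I * τ / 4) * (q ^ j.choose 2 * ((q ^ n)⁻¹) ^ j) := by
        rw [hqdef, nome, ← Complex.exp_nat_mul, ← Complex.exp_nat_mul, ← Complex.exp_nat_mul,
          ← Complex.exp_neg, ← Complex.exp_nat_mul, ← Complex.exp_add, ← Complex.exp_add,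
          ← Complex.exp_add, Nat.cast_choose_two, Nat.cast_choose_two, hkj]
        congr 1
        push_cast
        ring
      have hsgn : (-1 : ℂ) ^ k = -((-1) ^ n * (-1) ^ j) := by
        rw [hkj, zpow_sub₀ (by norm_num), zpow_add₀ (by norm_num), zpow_natCast, zpow_natCast,
          zpow_one, div_eq_mul_inv, mul_inv, ← inv_pow]
        norm_num
        ring
      rw [thetaTerm, hexp, hsgn, neg_pow ((q ^ n)⁻¹) j, hkj]
      push_cast
      rw [mul_zero, Complex.exp_zero]
      ring
  rw [tsum_eq_sum (s := Finset.Icc (-(n + 1) : ℤ) n) fun k hk ↦ by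
    rw [jacobiWeight, if_neg hk, mul_zero], hmain, ← Finset.mul_sum, hfin]
  have hs : ((-1 : ℂ) ^ n) ^ 2 = 1 := by rw [← pow_mul, mul_comm, pow_mul]; norm_num
  field_simp
  linear_combination qPoch q n ^ 2 * hs

/-- Jacobi's identity `∑ (-1)ⁿ (2n + 1) q^{(2n+1)²/8} = 2 η³`: as `n → ∞` the Gaussian binomials
tend to `1 / ∏ (1 - q^k)` and stay bounded. -/
theorem thetaMoment_one_eq (τ : ℍ) : thetaMoment 1 0 τ = 2 * ModularForm.eta τ ^ 3 := by
  set q := nome τ with hqdef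
  have hq : ‖q‖ < 1 := norm_nome_lt_one τ
  set Λ : ℂ := ∏' n : ℕ, (1 - q ^ (n + 1)) with hΛ
  have hetaq (n : ℕ) : eta_q n τ = q ^ (n + 1) := eta_q_eq_pow n τ
  have hlim : Tendsto (qPoch q) atTop (𝓝 Λ) :=
    (multipliable_one_sub_pow hq).hasProd.tendsto_prod_nat
  have hΛ0 : Λ ≠ 0 := by
    have := eta_tprod_ne_zero τ.2
    simpa only [hetaq] using this
  -- bounds for `(q)_n` and its inverse, uniform in `n`
  obtain ⟨A, hA⟩ := hlim.norm.bddAbove_range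
  obtain ⟨B, hB⟩ := (hlim.inv₀ hΛ0).norm.bddAbove_range
  have hA' (n : ℕ) : ‖qPoch q n‖ ≤ A := hA ⟨n, rfl⟩
  have hB' (n : ℕ) : ‖(qPoch q n)⁻¹‖ ≤ B := hB ⟨n, rfl⟩
  have hA0 : 0 ≤ A := (norm_nonneg _).trans (hA' 0)
  have hB0 : 0 ≤ B := (norm_nonneg _).trans (hB' 0)
  have hbound (n : ℕ) (k : ℤ) : ‖jacobiWeight q n k‖ ≤ A * (B * B) := by
    rw [jacobiWeight]
    split_ifs
    · rw [div_eq_mul_inv, mul_inv, norm_mul, norm_mul]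
      gcongr
      exacts [hA' _, hB' _, hB' _]
    · rw [norm_zero]; positivity
  have hw (k : ℤ) : Tendsto (fun n ↦ jacobiWeight q n k) atTop (𝓝 (Λ / (Λ * Λ))) := by
    have t1 : Tendsto (fun n : ℕ ↦ 2 * n + 1) atTop atTop :=
      tendsto_atTop_mono (fun n ↦ by simp only [id]; omega) tendsto_id
    have t2 : Tendsto (fun n : ℕ ↦ ((n : ℤ) - k).toNat) atTop atTop :=
      tendsto_atTop.mpr fun b ↦ (eventually_ge_atTop (b + k.toNat)).mono fun n hn ↦ by omega
    have t3 : Tendsto (fun n : ℕ ↦ ((n : ℤ) + 1 + k).toNat) atTop atTop :=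
      tendsto_atTop.mpr fun b ↦ (eventually_ge_atTop (b + (-k).toNat)).mono fun n hn ↦ by omega
    refine ((hlim.comp t1).div ((hlim.comp t2).mul (hlim.comp t3))
      (mul_ne_zero hΛ0 hΛ0)).congr' ?_
    filter_upwards [eventually_ge_atTop k.natAbs] with n hn
    -- `k` lies in the range of nonzero weights as soon as `n ≥ |k|`
    rw [jacobiWeight, if_pos (by rw [Finset.mem_Icc]; omega)]
    rfl
  have htend := tendsto_tsum_of_dominated_convergence
    (f := fun (n : ℕ) (k : ℤ) ↦ thetaTerm 1 0 τ k * jacobiWeight q n k)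
    (g := fun k ↦ thetaTerm 1 0 τ k * (Λ / (Λ * Λ)))
    (bound := fun k ↦ ‖thetaTerm 1 0 τ k‖ * (A * (B * B)))
    ((summable_thetaTerm 1 0 τ.im_pos).norm.mul_right _)
    (fun k ↦ (hw k).const_mul _)
    (.of_forall fun n k ↦ by rw [norm_mul]; gcongr; exact hbound n k)
  simp only [hqdef, tsum_thetaTerm_mul_jacobiWeight] at htend
  have huniq := tendsto_nhds_unique htend ((hlim.pow 2).const_mul _)
  rw [tsum_mul_right, ← thetaMoment] at huniq
  have h24 : Function.Periodic.qParam 24 τ ^ 3 = cexp (π * I * τ / 4) := by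
    rw [Function.Periodic.qParam, ← Complex.exp_nat_mul]
    congr 1
    push_cast
    ring
  rw [ModularForm.eta, mul_pow, h24]
  simp only [hetaq]
  rw [← hΛ]
  field_simp at huniq
  linear_combination huniq

/-! ### The recursion for the odd moments -/

theorem hasDerivAt_of_normalizedDeriv {F : ℍ → ℂ} (hF : MDiff F) (τ : ℍ) {a : ℂ}
    (ha : normalizedDerivOfComplex F τ = a) :
    HasDerivAt (F ∘ ofComplex) (2 * π * I * a) (τ : ℂ) := by
  refine (UpperHalfPlane.mdifferentiableAt_iff.mp (hF τ)).hasDerivAt.congr_deriv ?_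
  rw [← ha, normalizedDerivOfComplex, mul_inv_cancel_left₀ two_pi_I_ne_zero]

/-- The heat equation `8 D S(m) = S(m + 2)` combined with `D η³ = η³ E₂ / 8`: it turns an
evaluation of one moment into an evaluation of the next. -/
theorem thetaMoment_add_two {m : ℕ} {G : ℂ → ℂ} {G' : ℂ} (τ : ℍ)
    (h : ∀ w : ℍ, thetaMoment m 0 w = 2 * ModularForm.eta w ^ 3 * G w) (hG : HasDerivAt G G' τ) :
    π * I * thetaMoment (m + 2) 0 τ =
      2 * ModularForm.eta τ ^ 3 * (4 * G' + π * I * E2 τ * G τ) := by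
  have h1 := hasDerivAt_thetaMoment_snd m 0 τ.im_pos
  have hη : HasDerivAt ModularForm.eta (ModularForm.eta τ * (π * I / 12 * E2 τ)) τ := by
    refine (differentiableAt_eta_of_mem_upperHalfPlaneSet τ.2).hasDerivAt.congr_deriv ?_
    rw [← logDeriv_eta_eq_E2, logDeriv_apply, mul_div_cancel₀ _ (eta_ne_zero τ.2)]
  have h2 := ((hη.fun_pow 3).const_mul 2).fun_mul hG
  have h3 := h1.unique (h2.congr_of_eventuallyEq (by
    filter_upwards [isOpen_upperHalfPlaneSet.mem_nhds τ.2] with w hw using h ⟨w, hw⟩))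
  push_cast at h3
  linear_combination 4 * h3

theorem pi_mul_I_ne_zero : (π : ℂ) * I ≠ 0 :=
  mul_ne_zero (by exact_mod_cast Real.pi_ne_zero) I_ne_zero

section Moments

-- the Eisenstein series as functions on `ℂ`, where derivatives in `τ` are taken
local notation "e2" => E2 ∘ ofComplex
local notation "e4" => (E₄ : ℍ → ℂ) ∘ ofComplex
local notation "e6" => (E₆ : ℍ → ℂ) ∘ ofComplex

variable (τ : ℍ)

theorem hasDerivAt_e2 : HasDerivAt (e2) (2 * π * I * ((E2 τ ^ 2 - E₄ τ) / 12)) (τ : ℂ) :=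
  hasDerivAt_of_normalizedDeriv E2_mdifferentiable τ (ramanujan_E2 τ)

theorem hasDerivAt_e4 : HasDerivAt (e4) (2 * π * I * ((E2 τ * E₄ τ - E₆ τ) / 3)) (τ : ℂ) :=
  hasDerivAt_of_normalizedDeriv E₄.holo' τ (ramanujan_E4 τ)

theorem hasDerivAt_e6 : HasDerivAt (e6) (2 * π * I * ((E2 τ * E₆ τ - E₄ τ ^ 2) / 2)) (τ : ℂ) :=
  hasDerivAt_of_normalizedDeriv E₆.holo' τ (ramanujan_E6 τ)

theorem thetaMoment_three : thetaMoment 3 0 τ = 2 * ModularForm.eta τ ^ 3 * E2 τ := by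
  have := thetaMoment_add_two (m := 1) (G := fun _ ↦ 1) τ
    (fun w ↦ by rw [thetaMoment_one_eq, mul_one]) (hasDerivAt_const (τ : ℂ) (1 : ℂ))
  refine mul_left_cancel₀ pi_mul_I_ne_zero ?_
  linear_combination this

theorem thetaMoment_five : thetaMoment 5 0 τ = 2 * ModularForm.eta τ ^ 3 *
    (1 / 3 * (5 * E2 τ ^ 2 - 2 * E₄ τ)) := by
  have := thetaMoment_add_two (m := 3) (G := e2) τ
    (fun w ↦ by rw [thetaMoment_three, Function.comp_apply, ofComplex_apply]) (hasDerivAt_e2 τ)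
  rw [Function.comp_apply, ofComplex_apply] at this
  refine mul_left_cancel₀ pi_mul_I_ne_zero ?_
  linear_combination this

theorem thetaMoment_seven : thetaMoment 7 0 τ = 2 * ModularForm.eta τ ^ 3 *
    (1 / 9 * (35 * E2 τ ^ 3 - 42 * E2 τ * E₄ τ + 16 * E₆ τ)) := by
  have hP := hasDerivAt_e2 τ
  have hQ := hasDerivAt_e4 τ
  have hR := hasDerivAt_e6 τ
  have := thetaMoment_add_two (m := 5)
    (G := fun w ↦ 1 / 3 * (5 * (e2) w ^ 2 - 2 * (e4) w)) τ
    (fun w ↦ by simp only [thetaMoment_five, Function.comp_apply, ofComplex_apply])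
    ((((hP.fun_pow 2).const_mul 5).fun_sub
        (hQ.const_mul 2)).const_mul (1 / 3))
  simp only [Function.comp_apply, ofComplex_apply] at this
  push_cast at this
  refine mul_left_cancel₀ pi_mul_I_ne_zero ?_
  linear_combination this

theorem thetaMoment_nine : thetaMoment 9 0 τ = 2 * ModularForm.eta τ ^ 3 *
    (1 / 3 * (35 * E2 τ ^ 4 - 84 * E2 τ ^ 2 * E₄ τ - 12 * E₄ τ ^ 2 + 64 * E2 τ * E₆ τ)) := by
  have hP := hasDerivAt_e2 τ
  have hQ := hasDerivAt_e4 τ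
  have hR := hasDerivAt_e6 τ
  have := thetaMoment_add_two (m := 7)
    (G := fun w ↦ 1 / 9 * (35 * (e2) w ^ 3 - 42 * (e2) w * (e4) w + 16 * (e6) w)) τ
    (fun w ↦ by simp only [thetaMoment_seven, Function.comp_apply, ofComplex_apply])
    (((((hP.fun_pow 3).const_mul 35).fun_sub
        ((hP.const_mul 42).fun_mul hQ)).fun_add
        (hR.const_mul 16)).const_mul (1 / 9))
  simp only [Function.comp_apply, ofComplex_apply] at this
  push_cast at this
  refine mul_left_cancel₀ pi_mul_I_ne_zero ?_
  linear_combination this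

theorem thetaMoment_eleven : thetaMoment 11 0 τ = 2 * ModularForm.eta τ ^ 3 *
    (1 / 9 * (385 * E2 τ ^ 5 - 1540 * E2 τ ^ 3 * E₄ τ - 660 * E2 τ * E₄ τ ^ 2
      + 1760 * E2 τ ^ 2 * E₆ τ + 64 * E₄ τ * E₆ τ)) := by
  have hP := hasDerivAt_e2 τ
  have hQ := hasDerivAt_e4 τ
  have hR := hasDerivAt_e6 τ
  have := thetaMoment_add_two (m := 9)
    (G := fun w ↦ 1 / 3 * (35 * (e2) w ^ 4 - 84 * (e2) w ^ 2 * (e4) w - 12 * (e4) w ^ 2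
      + 64 * (e2) w * (e6) w)) τ
    (fun w ↦ by simp only [thetaMoment_nine, Function.comp_apply, ofComplex_apply])
    ((((((hP.fun_pow 4).const_mul 35).fun_sub
        (((hP.fun_pow 2).const_mul 84).fun_mul hQ)).fun_sub
        ((hQ.fun_pow 2).const_mul 12)).fun_add
        ((hP.const_mul 64).fun_mul hR)).const_mul (1 / 3))
  simp only [Function.comp_apply, ofComplex_apply] at this
  push_cast at this
  refine mul_left_cancel₀ pi_mul_I_ne_zero ?_
  linear_combination this

theorem thetaMoment_thirteen : thetaMoment 13 0 τ = 2 * ModularForm.eta τ ^ 3 *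
    (1 / 27 * (5005 * E2 τ ^ 6 - 30030 * E2 τ ^ 4 * E₄ τ - 25740 * E2 τ ^ 2 * E₄ τ ^ 2
      + 552 * E₄ τ ^ 3 + 45760 * E2 τ ^ 3 * E₆ τ + 4992 * E2 τ * E₄ τ * E₆ τ
      - 512 * E₆ τ ^ 2)) := by
  have hP := hasDerivAt_e2 τ
  have hQ := hasDerivAt_e4 τ
  have hR := hasDerivAt_e6 τ
  have := thetaMoment_add_two (m := 11)
    (G := fun w ↦ 1 / 9 * (385 * (e2) w ^ 5 - 1540 * (e2) w ^ 3 * (e4) w - 660 * (e2) w * (e4) w ^ 2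
      + 1760 * (e2) w ^ 2 * (e6) w + 64 * (e4) w * (e6) w)) τ
    (fun w ↦ by simp only [thetaMoment_eleven, Function.comp_apply, ofComplex_apply])
    (((((((hP.fun_pow 5).const_mul 385).fun_sub
        (((hP.fun_pow 3).const_mul 1540).fun_mul hQ)).fun_sub
        ((hP.const_mul 660).fun_mul (hQ.fun_pow 2))).fun_add
        (((hP.fun_pow 2).const_mul 1760).fun_mul hR)).fun_add
        ((hQ.const_mul 64).fun_mul hR)).const_mul (1 / 9))
  simp only [Function.comp_apply, ofComplex_apply] at this
  push_cast at this
  refine mul_left_cancel₀ pi_mul_I_ne_zero ?_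
  linear_combination this

theorem thetaMoment_fifteen : thetaMoment 15 0 τ = 2 * ModularForm.eta τ ^ 3 *
    (1 / 27 * (25025 * E2 τ ^ 7 - 210210 * E2 τ ^ 5 * E₄ τ - 300300 * E2 τ ^ 3 * E₄ τ ^ 2
      + 19320 * E2 τ * E₄ τ ^ 3 + 400400 * E2 τ ^ 4 * E₆ τ + 87360 * E2 τ ^ 2 * E₄ τ * E₆ τ
      - 3648 * E₄ τ ^ 2 * E₆ τ - 17920 * E2 τ * E₆ τ ^ 2)) := by
  have hP := hasDerivAt_e2 τ
  have hQ := hasDerivAt_e4 τ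
  have hR := hasDerivAt_e6 τ
  have := thetaMoment_add_two (m := 13)
    (G := fun w ↦ 1 / 27 * (5005 * (e2) w ^ 6 - 30030 * (e2) w ^ 4 * (e4) w
      - 25740 * (e2) w ^ 2 * (e4) w ^ 2 + 552 * (e4) w ^ 3 + 45760 * (e2) w ^ 3 * (e6) w
      + 4992 * (e2) w * (e4) w * (e6) w - 512 * (e6) w ^ 2)) τ
    (fun w ↦ by simp only [thetaMoment_thirteen, Function.comp_apply, ofComplex_apply])
    (((((((((hP.fun_pow 6).const_mul 5005).fun_sub
        (((hP.fun_pow 4).const_mul 30030).fun_mul hQ)).fun_sub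
        (((hP.fun_pow 2).const_mul 25740).fun_mul (hQ.fun_pow 2))).fun_add
        ((hQ.fun_pow 3).const_mul 552)).fun_add
        (((hP.fun_pow 3).const_mul 45760).fun_mul hR)).fun_add
        (((hP.const_mul 4992).fun_mul hQ).fun_mul hR)).fun_sub
        ((hR.fun_pow 2).const_mul 512)).const_mul (1 / 27))
  simp only [Function.comp_apply, ofComplex_apply] at this
  push_cast at this
  refine mul_left_cancel₀ pi_mul_I_ne_zero ?_
  linear_combination this

end Moments

end ThetaEval

theorem mainTheorem3 (τ : UpperHalfPlane) (q P Q R h : ℂ) (ϑ₁ : ℂ → ℂ)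
    (hq : q = ThetaEval.nome τ)
    (hP : P = ThetaEval.P q) (hQ : Q = ThetaEval.Q q) (hR : R = ThetaEval.R q)
    (hh : h = ModularForm.eta τ)
    (hϑ : ϑ₁ = fun z => ThetaEval.theta1 z τ) :
    ((1 / 2 : ℂ) * iteratedDeriv 9 ϑ₁ 0 = ThetaEval.S3 9 τ ∧
      ThetaEval.S3 9 τ =
        1 / 3 * h ^ 3 * (35 * P ^ 4 - 84 * P ^ 2 * Q - 12 * Q ^ 2 + 64 * P * R)) ∧
    (-(1 / 2 : ℂ) * iteratedDeriv 11 ϑ₁ 0 = ThetaEval.S3 11 τ ∧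
      ThetaEval.S3 11 τ =
        1 / 9 * h ^ 3 * (385 * P ^ 5 - 1540 * P ^ 3 * Q - 660 * P * Q ^ 2
          + 1760 * P ^ 2 * R + 64 * Q * R)) ∧
    ((1 / 2 : ℂ) * iteratedDeriv 13 ϑ₁ 0 = ThetaEval.S3 13 τ ∧
      ThetaEval.S3 13 τ =
        1 / 27 * h ^ 3 * (5005 * P ^ 6 - 30030 * P ^ 4 * Q - 25740 * P ^ 2 * Q ^ 2
          + 552 * Q ^ 3 + 45760 * P ^ 3 * R + 4992 * P * Q * R - 512 * R ^ 2)) ∧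
    (-(1 / 2 : ℂ) * iteratedDeriv 15 ϑ₁ 0 = ThetaEval.S3 15 τ ∧
      ThetaEval.S3 15 τ =
        1 / 27 * h ^ 3 * (25025 * P ^ 7 - 210210 * P ^ 5 * Q - 300300 * P ^ 3 * Q ^ 2
          + 19320 * P * Q ^ 3 + 400400 * P ^ 4 * R + 87360 * P ^ 2 * Q * R
          - 3648 * Q ^ 2 * R - 17920 * P * R ^ 2)) := by
  -- `ϑ₁` carries the factor `-i`, so its odd derivatives of order `m` at `0` are `-i^{m+1} T m`
  subst hq hP hQ hR hh hϑ
  have hmom {m : ℕ} (hm : Odd m) := ThetaEval.S3_eq hm τ.im_pos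
  rw [ThetaEval.P_nome, ThetaEval.Q_nome, ThetaEval.R_nome, hmom (m := 9) (by decide),
    hmom (m := 11) (by decide), hmom (m := 13) (by decide), hmom (m := 15) (by decide)]
  simp only [ThetaEval.iteratedDeriv_theta1 _ τ.im_pos]
  refine ⟨⟨?_, ?_⟩, ⟨?_, ?_⟩, ⟨?_, ?_⟩, ⟨?_, ?_⟩⟩
  · have : Complex.I ^ 10 = -1 := by rw [show 10 = 2 * 5 by rfl, pow_mul, Complex.I_sq]; norm_num
    linear_combination -(1 / 2 : ℂ) * ThetaEval.thetaMoment 9 0 τ * this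
  · rw [ThetaEval.thetaMoment_nine]
    ring
  · have : Complex.I ^ 12 = 1 := by rw [show 12 = 2 * 6 by rfl, pow_mul, Complex.I_sq]; norm_num
    linear_combination (1 / 2 : ℂ) * ThetaEval.thetaMoment 11 0 τ * this
  · rw [ThetaEval.thetaMoment_eleven]
    ring
  · have : Complex.I ^ 14 = -1 := by rw [show 14 = 2 * 7 by rfl, pow_mul, Complex.I_sq]; norm_num
    linear_combination -(1 / 2 : ℂ) * ThetaEval.thetaMoment 13 0 τ * this
  · rw [ThetaEval.thetaMoment_thirteen]
    ring
  · have : Complex.I ^ 16 = 1 := by rw [show 16 = 2 * 8 by rfl, pow_mul, Complex.I_sq]; norm_num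
    linear_combination (1 / 2 : ℂ) * ThetaEval.thetaMoment 15 0 τ * this
  · rw [ThetaEval.thetaMoment_fifteen]
    ring
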